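/- Consider a finite stochastic game with public monitoring: a nonempty finite set $I$ of players, a nonempty finite set $S$ of states, a finite set $Y$ of public signals, a nonempty finite action set $B$ common to all players, stage payoffs $u_i(a,s)$, and for each state $s$ and action profile $a\in B^I$ a probability distribution $p(\cdot,\cdot\mid s,a)$ on $S\times Y$ of the next state and the public signal; this last object is the monitoring structure $\Pi$. Both $u$ and $p$ are extended multilinearly to mixed actions. The game is symmetric: for every permutation $\tau$ of $I$, $u_{\tau(i)}(a\circ\tau^{-1},s)=u_i(a,s)$ and $p(\cdot,\cdot\mid s,a\circ\tau^{-1})=p(\cdot,\cdot\mid s,a)$. Players maximize expected average discounted payoffs with discount factor $\delta\in(0,1)$. A public history is a sequence $(s^1,y^1,s^2,\dots,y^{k-1},s^k)$ of past states and signals together with the current state. A strongly symmetric equilibrium (SSE) of the game with initial state $s$ is a profile of public strategies whose continuation after every public history starting at $s$ is a Nash equilibrium and in which all players use the same mixed action after every such history. Let $E^\delta_{SS}(s)\subseteq\mathbb R$ be the set of (common) SSE payoffs with initial state $s$. For $\lambda\in\{-1,+1\}$ let $k_{SS}(\lambda;\Pi)\in[-\infty,+\infty]$ be the supremum (with $\sup\emptyset=-\infty$)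 of $\lambda v$ over all $\alpha=(\alpha_s)_{s\in S}\in\Delta(B)^S$, $v\in\mathbb R$ and $x_s(t,y)\in\mathbb R$ $(s,t\in S,\ y\in Y)$ such that, writing $(\alpha_s)$ for the profile in which all players use $\alpha_s$, - $v=u_i((\alpha_s),s)+\sum_{(t,y)}x_s(t,y)\,p(t,y\mid s,(\alpha_s))$ for all $s\in S$, $i\in I$; - $v\ge u_i((b,(\alpha_s)_{-i}),s)+\sum_{(t,y)}x_s(t,y)\,p(t,y\mid s,(b,(\alpha_s)_{-i}))$ for all $s\in S$, $i\in I$, $b\in B$; - $\lambda\sum_{s\in T}x_s(\xi(s),\psi(s))\le 0$ for every $T\subseteq S$, every permutation $\xi$ of $T$ and every $\psi:T\to Y$. Then: 1. For every $\delta\in(0,1)$, $\ \bigcap_{s\in S}E^\delta_{SS}(s)\subseteq[-k_{SS}(-1;\Pi),\,k_{SS}(+1;\Pi)]$. 2. For all real $\underline z\le\bar z$ with $-k_{SS}(-1;\Pi)<\underline z$ and $\bar z<k_{SS}(+1;\Pi)$ there is $\bar\delta\in(0,1)$ such that $[\underline z,\bar z]\subseteq E^\delta_{SS}(s)$ for all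 $s\in S$ and all $\delta\in[\bar\delta,1)$. Both statements also hold with $E^\delta_{SS}(s)$ replaced by the set of payoffs of SSE in pure strategies, and $k_{SS}(\lambda;\Pi)$ replaced by the analogous supremum in which every $\alpha_s$ is required to be a pure action. -/

import Mathlib

noncomputable section

/-- A finite stochastic game with public monitoring in which every player `i : I` has the same
action set `B`. States are `S`, public signals are `Y`; `u i s a` is the stage payoff of player
`i` at state `s` under the action profile `a`, and `p s a (t, y)` is the probability that the next
state is `t` and the public signal is `y`. -/
structure StochasticGame (I S B Y : Type*) [Fintype S] [Fintype Y] where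
  u : I → S → (I → B) → ℝ
  p : S → (I → B) → S × Y → ℝ
  p_nonneg : ∀ s a ty, 0 ≤ p s a ty
  p_sum : ∀ s a, ∑ ty, p s a ty = 1

/-- Mixed actions: probability vectors on `B`. -/
abbrev MixedAction (B : Type*) [Fintype B] : Type _ := stdSimplex ℝ B

/-- The degenerate mixed action that plays `b` for sure. -/
def pureAction {B : Type*} [Fintype B] [DecidableEq B] (b : B) : MixedAction B :=
  ⟨Pi.single b 1, single_mem_stdSimplex ℝ b⟩

/-- A (behavior) strategy in the game with a given initial state: it selects a mixed action after
every private history, the chronological list of (own action, public signal, next state). -/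
abbrev Strategy (S B Y : Type*) [Fintype B] : Type _ := List (B × Y × S) → MixedAction B

/-- A public strategy in the game with a given initial state: it selects a mixed action after every
public history, the chronological list of (public signal, next state). -/
abbrev PublicStrategy (S B Y : Type*) [Fintype B] : Type _ := List (Y × S) → MixedAction B

namespace PublicStrategy

variable {S B Y : Type*} [Fintype B]

/-- A public strategy as a strategy that ignores the player's own past actions. -/
def toStrategy (σ : PublicStrategy S B Y) : Strategy S B Y := fun l => σ (l.map Prod.snd)

/-- The continuation of a public strategy after the public history `h`. -/
def after (σ : PublicStrategy S B Y) (h : List (Y × S)) : PublicStrategy S B Y :=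
  fun l => σ (h ++ l)

end PublicStrategy

/-- The current state after the public history `h`, when the initial state is `s`. -/
def currentState {S Y : Type*} (s : S) (h : List (Y × S)) : S :=
  (h.getLast?.map Prod.snd).getD s

namespace StochasticGame

variable {I S B Y : Type*} [Fintype I] [DecidableEq I] [Fintype S] [Fintype B] [Fintype Y]

/-- Symmetry: relabelling the players by any permutation relabels the payoffs accordingly and does
not affect the distribution of the next state and the signal. (In `a ∘ τ.symm`, player `τ i` plays
what player `i` plays in `a`.) -/
def IsSymmetric (G : StochasticGame I S B Y) : Prop :=
  ∀ (τ : Equiv.Perm I) (s : S) (a : I → B),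
    (∀ i, G.u (τ i) s (a ∘ τ.symm) = G.u i s a) ∧ G.p s (a ∘ τ.symm) = G.p s a

/-- Expected stage payoff under a profile of independent mixed actions. -/
def uMix (G : StochasticGame I S B Y) (i : I) (s : S) (α : I → MixedAction B) : ℝ :=
  ∑ a : I → B, (∏ j, (α j : B → ℝ) (a j)) * G.u i s a

/-- Distribution of next state and signal under a profile of independent mixed actions. -/
def pMix (G : StochasticGame I S B Y) (s : S) (α : I → MixedAction B) (ty : S × Y) : ℝ :=
  ∑ a : I → B, (∏ j, (α j : B → ℝ) (a j)) * G.p s a ty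

/-- `G.expStage i k s σ` is the expectation of the stage payoff of player `i` received `k` periods
after the start of the game with initial state `s`, when the profile `σ` is played. -/
def expStage (G : StochasticGame I S B Y) (i : I) : ℕ → S → (I → Strategy S B Y) → ℝ
  | 0, s, σ => G.uMix i s (fun j => σ j [])
  | k + 1, s, σ =>
      ∑ a : I → B, (∏ j, (σ j [] : B → ℝ) (a j)) *
        ∑ ty : S × Y, G.p s a ty *
          G.expStage i k ty.1 (fun j l => σ j ((a j, ty.2, ty.1) :: l))

/-- Average discounted expected payoff of player `i` in the game with initial state `s`. -/
def payoff (G : StochasticGame I S B Y) (δ : ℝ) (i : I) (s : S) (σ : I → Strategy S B Y) : ℝ :=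
  (1 - δ) * ∑' k : ℕ, δ ^ k * G.expStage i k s σ

/-- Nash equilibrium of the game with initial state `s`. -/
def IsNash (G : StochasticGame I S B Y) (δ : ℝ) (s : S) (σ : I → Strategy S B Y) : Prop :=
  ∀ (i : I) (τ : Strategy S B Y), G.payoff δ i s (Function.update σ i τ) ≤ G.payoff δ i s σ

/-- Perfect public equilibrium of the game with initial state `s`: a profile of public strategies
whose continuation after every public history is a Nash equilibrium. -/
def IsPPE (G : StochasticGame I S B Y) (δ : ℝ) (s : S) (σ : I → PublicStrategy S B Y) : Prop :=
  ∀ h : List (Y × S),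
    G.IsNash δ (currentState s h) (fun i => ((σ i).after h).toStrategy)

/-- Strongly symmetric equilibrium: a perfect public equilibrium in which all players choose the
same mixed action after every public history. -/
def IsSSE (G : StochasticGame I S B Y) (δ : ℝ) (s : S) (σ : I → PublicStrategy S B Y) : Prop :=
  G.IsPPE δ s σ ∧ ∀ i j h, σ i h = σ j h

/-- The set of (common) payoffs of strongly symmetric equilibria with initial state `s`. -/
def sseSet (G : StochasticGame I S B Y) (δ : ℝ) (s : S) : Set ℝ :=
  {v | ∃ σ : I → PublicStrategy S B Y, G.IsSSE δ s σ ∧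
    ∀ i, G.payoff δ i s (fun j => (σ j).toStrategy) = v}

variable [DecidableEq B]

/-- The set of payoffs of pure-strategy strongly symmetric equilibria with initial state `s`. -/
def pureSseSet (G : StochasticGame I S B Y) (δ : ℝ) (s : S) : Set ℝ :=
  {v | ∃ σ : I → PublicStrategy S B Y, G.IsSSE δ s σ ∧ (∀ i h, ∃ b, σ i h = pureAction b) ∧
    ∀ i, G.payoff δ i s (fun j => (σ j).toStrategy) = v}

/-- Feasibility of `(α, v, x)` in the score maximization problem in direction `l`
(`l = 1` or `l = -1`), where `α s` is the mixed action common to all players at state `s` and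
`x s t y` is the transfer at state `s` when the next state is `t` and the signal is `y`. -/
structure Feasible (G : StochasticGame I S B Y) (l : ℝ) (α : S → MixedAction B) (v : ℝ)
    (x : S → S → Y → ℝ) : Prop where
  value : ∀ s i, v = G.uMix i s (fun _ => α s) +
    ∑ ty : S × Y, x s ty.1 ty.2 * G.pMix s (fun _ => α s) ty
  incentive : ∀ s i b, G.uMix i s (Function.update (fun _ => α s) i (pureAction b)) +
    ∑ ty : S × Y, x s ty.1 ty.2 *
      G.pMix s (Function.update (fun _ => α s) i (pureAction b)) ty ≤ v
  cycle : ∀ (T : Finset S) (ξ : Equiv.Perm T) (ψ : T → Y),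
    l * ∑ s : T, x s (ξ s) (ψ s) ≤ 0

/-- The score in direction `l`: the supremum of `l * v` over the feasible `(α, v, x)`
(`-∞` if there is none). -/
def kSS (G : StochasticGame I S B Y) (l : ℝ) : EReal :=
  sSup {r | ∃ α v x, G.Feasible l α v x ∧ r = ((l * v : ℝ) : EReal)}

/-- The score in direction `l` when the actions `α s` are required to be pure. -/
def kSSPure (G : StochasticGame I S B Y) (l : ℝ) : EReal :=
  sSup {r | ∃ (a : S → B) (v : ℝ) (x : S → S → Y → ℝ),
    G.Feasible l (fun s => pureAction (a s)) v x ∧ r = ((l * v : ℝ) : EReal)}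

end StochasticGame

end

noncomputable section

set_option linter.unusedSectionVars false

open Finset

/-! Everything is proved for strategies restricted to a set `A` of mixed actions; `A = univ` and the
set of pure actions give the two halves.

Upper bound (`score_ge_of_mem`): choose at every state an equilibrium payoff almost extremal in
direction `l` and decompose it into stage payoff and continuation payoffs. Rescaled continuation
values serve as transfers. Along a cycle of states their `l`-sum is at most a telescoping sum of
differences of the extremal values, hence at most zero.

Lower bound (`exists_discount_Icc_subset`): take feasible data with `v` above the target interval
and `v'` below it. To pay `z`, carry a promised payoff `w` starting at `z`, generated by `(v, x)`
when `w ≥ z` and by `(v', x')` when `w < z`. With `c = (1 - δ) / δ` the next promise is `w - c * (v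
- w) + c * x`, which keeps promises and incentives exactly. The cycle condition yields a potential
`θ` (`exists_potential`) for which `w + c * θ` does not increase in the first regime, and
symmetrically in the second. So promises stay within order `c` of `z` (`promise_bounds`), and
bounded promises are equilibrium payoffs by the one-shot deviation principle (`isPPE_of_oneShot`).
-/

/-- Expectation of `F` when the players' actions are drawn independently from `α`. -/
def mixExp {I B : Type*} [Fintype I] [DecidableEq I] [Fintype B] (α : I → MixedAction B)
    (F : (I → B) → ℝ) : ℝ :=
  ∑ a : I → B, (∏ j, (α j : B → ℝ) (a j)) * F a

/-! ### Expectations under independent mixed actions. -/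

section mixExp

variable {I B : Type*} [Fintype I] [DecidableEq I] [Fintype B]

theorem mixExp_weight_nonneg (α : I → MixedAction B) (a : I → B) :
    0 ≤ ∏ j, (α j : B → ℝ) (a j) :=
  Finset.prod_nonneg fun j _ => (α j).2.1 (a j)

theorem mixExp_const (α : I → MixedAction B) (c : ℝ) : mixExp α (fun _ => c) = c := by
  have h : ∑ a : I → B, ∏ j, (α j : B → ℝ) (a j) = 1 := by
    rw [← Fintype.prod_sum]
    exact Finset.prod_eq_one fun j _ => (α j).2.2
  rw [mixExp, ← Finset.sum_mul, h, one_mul]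

theorem mixExp_mono (α : I → MixedAction B) {F F' : (I → B) → ℝ} (h : ∀ a, F a ≤ F' a) :
    mixExp α F ≤ mixExp α F' :=
  Finset.sum_le_sum fun a _ => mul_le_mul_of_nonneg_left (h a) (mixExp_weight_nonneg α a)

theorem mixExp_add (α : I → MixedAction B) (F F' : (I → B) → ℝ) :
    mixExp α (fun a => F a + F' a) = mixExp α F + mixExp α F' := by
  simp only [mixExp, mul_add, Finset.sum_add_distrib]

theorem mixExp_const_mul (α : I → MixedAction B) (c : ℝ) (F : (I → B) → ℝ) :
    mixExp α (fun a => c * F a) = c * mixExp α F := by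
  simp only [mixExp, Finset.mul_sum]
  exact Finset.sum_congr rfl fun a _ => by ring

theorem mixExp_sum {κ : Type*} [Fintype κ] (α : I → MixedAction B) (F : κ → (I → B) → ℝ) :
    mixExp α (fun a => ∑ k, F k a) = ∑ k, mixExp α (F k) := by
  simp only [mixExp, Finset.mul_sum]
  exact Finset.sum_comm

theorem abs_mixExp_le (α : I → MixedAction B) {F : (I → B) → ℝ} {M : ℝ} (h : ∀ a, |F a| ≤ M) :
    |mixExp α F| ≤ M := by
  rw [abs_le]
  constructor
  · calc -M = mixExp α (fun _ => -M) := (mixExp_const α _).symm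
      _ ≤ _ := mixExp_mono α fun a => (abs_le.1 (h a)).1
  · calc mixExp α F ≤ mixExp α (fun _ => M) := mixExp_mono α fun a => (abs_le.1 (h a)).2
      _ = M := mixExp_const α _

/-- Linearity in player `i`'s own mixed action: this is why incentive constraints against pure
deviations suffice. -/
theorem mixExp_update [DecidableEq B] (α : I → MixedAction B) (i : I) (β : MixedAction B)
    (F : (I → B) → ℝ) :
    mixExp (Function.update α i β) F =
      ∑ b, (β : B → ℝ) b * mixExp (Function.update α i (pureAction b)) F := by
  have key : ∀ (γ : MixedAction B) (a : I → B),
      ∏ j, (Function.update α i γ j : B → ℝ) (a j) =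
        (γ : B → ℝ) (a i) * ∏ j ∈ Finset.univ.erase i, (α j : B → ℝ) (a j) := by
    intro γ a
    rw [← Finset.mul_prod_erase Finset.univ _ (Finset.mem_univ i), Function.update_self]
    congr 1
    refine Finset.prod_congr rfl fun j hj => ?_
    rw [Function.update_of_ne (Finset.ne_of_mem_erase hj)]
  simp only [mixExp, key, Finset.mul_sum]
  rw [Finset.sum_comm]
  refine Finset.sum_congr rfl fun a _ => ?_
  rw [Finset.sum_eq_single (a i)]
  · simp [pureAction]; ring
  · intro b _ hb
    simp [pureAction, hb.symm]
  · simp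

theorem mixExp_update_le [DecidableEq B] (α : I → MixedAction B) (i : I) (β : MixedAction B)
    (F : (I → B) → ℝ) {c : ℝ}
    (h : ∀ b, mixExp (Function.update α i (pureAction b)) F ≤ c) :
    mixExp (Function.update α i β) F ≤ c := by
  rw [mixExp_update]
  calc _ ≤ ∑ b, (β : B → ℝ) b * c :=
        Finset.sum_le_sum fun b _ => mul_le_mul_of_nonneg_left (h b) (β.2.1 b)
    _ = c := by rw [← Finset.sum_mul, show ∑ b, (β : B → ℝ) b = 1 from β.2.2, one_mul]

end mixExp

/-! ### Public histories and continuations. -/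

theorem currentState_append {S Y : Type*} (s : S) (h : List (Y × S)) (y : Y) (t : S) :
    currentState s (h ++ [(y, t)]) = t := by
  simp [currentState]

theorem currentState_currentState_append {S Y : Type*} (s : S) (h h' : List (Y × S)) :
    currentState (currentState s h) h' = currentState s (h ++ h') := by
  rcases List.eq_nil_or_concat h' with rfl | ⟨l, ⟨y, t⟩, rfl⟩
  · simp [currentState]
  · rw [List.concat_eq_append, ← List.append_assoc, currentState_append, currentState_append]

namespace PublicStrategy

variable {S B Y : Type*} [Fintype B]

theorem after_nil (σ : PublicStrategy S B Y) : σ.after [] = σ := rfl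

theorem after_after (σ : PublicStrategy S B Y) (h h' : List (Y × S)) :
    (σ.after h).after h' = σ.after (h ++ h') := by
  funext l
  simp [after]

end PublicStrategy

/-! ### Recursive payoffs and the one-shot deviation principle. -/

namespace StochasticGame

variable {I S B Y : Type*} [Fintype I] [DecidableEq I] [Fintype S] [Fintype B] [Fintype Y]

theorem uMix_eq_mixExp (G : StochasticGame I S B Y) (i : I) (s : S) (α : I → MixedAction B) :
    G.uMix i s α = mixExp α (G.u i s) := rfl

/-- Expected value of the current payoff and of the continuation value `w`, weighted by `1 - δ`
and `δ`, at the action profile `a`. -/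
def oneShot (G : StochasticGame I S B Y) (δ : ℝ) (i : I) (s : S) (w : S → Y → ℝ) (a : I → B) : ℝ :=
  (1 - δ) * G.u i s a + δ * ∑ ty : S × Y, G.p s a ty * w ty.1 ty.2

theorem mixExp_oneShot (G : StochasticGame I S B Y) (δ : ℝ) (i : I) (s : S) (w : S → Y → ℝ)
    (α : I → MixedAction B) :
    mixExp α (G.oneShot δ i s w) =
      (1 - δ) * G.uMix i s α + δ * ∑ ty : S × Y, w ty.1 ty.2 * G.pMix s α ty := by
  unfold oneShot
  rw [mixExp_add, mixExp_const_mul, mixExp_const_mul, mixExp_sum, uMix_eq_mixExp]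
  congr 2
  refine Finset.sum_congr rfl fun ty _ => ?_
  simp only [mul_comm (G.p s _ ty)]
  rw [mixExp_const_mul]
  rfl

theorem pMix_sum (G : StochasticGame I S B Y) (s : S) (α : I → MixedAction B) :
    ∑ ty, G.pMix s α ty = 1 := by
  have : ∑ ty, G.pMix s α ty = mixExp α (fun a => ∑ ty, G.p s a ty) := (mixExp_sum α _).symm
  rw [this]
  simp only [G.p_sum, mixExp_const]

/-- The profile that follows `σ` after the first-period actions `a` and the outcome `ty`. -/
def contProfile (σ : I → Strategy S B Y) (a : I → B) (ty : S × Y) : I → Strategy S B Y :=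
  fun j l => σ j ((a j, ty.2, ty.1) :: l)

theorem expStage_succ (G : StochasticGame I S B Y) (i : I) (k : ℕ) (s : S)
    (σ : I → Strategy S B Y) :
    G.expStage i (k + 1) s σ = mixExp (fun j => σ j []) fun a =>
      ∑ ty, G.p s a ty * G.expStage i k ty.1 (contProfile σ a ty) := rfl

theorem abs_sum_p_mul_le (G : StochasticGame I S B Y) (s : S) (a : I → B) {f : S × Y → ℝ} {M : ℝ}
    (h : ∀ ty, |f ty| ≤ M) : |∑ ty, G.p s a ty * f ty| ≤ M := by
  calc _ ≤ ∑ ty, |G.p s a ty * f ty| := Finset.abs_sum_le_sum_abs _ _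
    _ ≤ ∑ ty, G.p s a ty * M := Finset.sum_le_sum fun ty _ => by
        rw [abs_mul, abs_of_nonneg (G.p_nonneg s a ty)]
        exact mul_le_mul_of_nonneg_left (h ty) (G.p_nonneg s a ty)
    _ = M := by rw [← Finset.sum_mul, G.p_sum, one_mul]

/-- A bound on all stage payoffs. -/
def payoffBound (G : StochasticGame I S B Y) : ℝ := ∑ i, ∑ s, ∑ a, |G.u i s a|

theorem abs_u_le (G : StochasticGame I S B Y) (i : I) (s : S) (a : I → B) :
    |G.u i s a| ≤ G.payoffBound := by
  unfold payoffBound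
  calc |G.u i s a| ≤ ∑ a, |G.u i s a| :=
        Finset.single_le_sum (f := fun a => |G.u i s a|) (fun _ _ => abs_nonneg _) (mem_univ a)
    _ ≤ ∑ s, ∑ a, |G.u i s a| :=
        Finset.single_le_sum (f := fun s => ∑ a, |G.u i s a|) (fun _ _ => by positivity)
          (mem_univ s)
    _ ≤ _ :=
        Finset.single_le_sum (f := fun i => ∑ s, ∑ a, |G.u i s a|) (fun _ _ => by positivity)
          (mem_univ i)

theorem abs_expStage_le (G : StochasticGame I S B Y) (i : I) (k : ℕ) :
    ∀ (s : S) (σ : I → Strategy S B Y), |G.expStage i k s σ| ≤ G.payoffBound := by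
  induction k with
  | zero => exact fun s σ => abs_mixExp_le _ fun a => G.abs_u_le i s a
  | succ k ih =>
    intro s σ
    rw [expStage_succ]
    exact abs_mixExp_le _ fun a => G.abs_sum_p_mul_le s a fun ty => ih _ _

theorem summable_expStage (G : StochasticGame I S B Y) {δ : ℝ} (h0 : 0 < δ) (h1 : δ < 1)
    (i : I) (s : S) (σ : I → Strategy S B Y) :
    Summable fun k => δ ^ k * G.expStage i k s σ := by
  refine Summable.of_norm_bounded
    ((summable_geometric_of_lt_one h0.le h1).mul_right G.payoffBound) fun k => ?_
  rw [Real.norm_eq_abs, abs_mul, abs_of_pos (pow_pos h0 k)]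
  exact mul_le_mul_of_nonneg_left (G.abs_expStage_le i k s σ) (pow_pos h0 k).le

theorem abs_payoff_le (G : StochasticGame I S B Y) {δ : ℝ} (h0 : 0 < δ) (h1 : δ < 1)
    (i : I) (s : S) (σ : I → Strategy S B Y) : |G.payoff δ i s σ| ≤ G.payoffBound := by
  have hg := (summable_geometric_of_lt_one h0.le h1).mul_right G.payoffBound
  have h : |∑' k, δ ^ k * G.expStage i k s σ| ≤ ∑' k, δ ^ k * G.payoffBound := by
    rw [← Real.norm_eq_abs]
    refine tsum_of_norm_bounded hg.hasSum fun k => ?_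
    rw [Real.norm_eq_abs, abs_mul, abs_of_pos (pow_pos h0 k)]
    exact mul_le_mul_of_nonneg_left (G.abs_expStage_le i k s σ) (pow_pos h0 k).le
  rw [tsum_mul_right, tsum_geometric_of_lt_one h0.le h1] at h
  have h1' : 0 < 1 - δ := by linarith
  rw [payoff, abs_mul, abs_of_pos h1']
  calc _ ≤ (1 - δ) * ((1 - δ)⁻¹ * G.payoffBound) := mul_le_mul_of_nonneg_left h h1'.le
    _ = _ := by rw [← mul_assoc, mul_inv_cancel₀ h1'.ne', one_mul]

/-- Split off the first term of the discounted series; finite sums over actions and outcomes commute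
with the summable tail. -/
theorem payoff_eq (G : StochasticGame I S B Y) {δ : ℝ} (h0 : 0 < δ) (h1 : δ < 1)
    (i : I) (s : S) (σ : I → Strategy S B Y) :
    G.payoff δ i s σ = mixExp (fun j => σ j []) fun a =>
      G.oneShot δ i s (fun t y => G.payoff δ i t (contProfile σ a (t, y))) a := by
  have hs := G.summable_expStage h0 h1 i s σ
  have e : ∀ k, δ ^ (k + 1) * G.expStage i (k + 1) s σ =
      ∑ a : I → B, ∑ ty : S × Y, ((∏ j, (σ j [] : B → ℝ) (a j)) * G.p s a ty * δ) *
        (δ ^ k * G.expStage i k ty.1 (contProfile σ a ty)) := by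
    intro k
    rw [expStage_succ, mixExp, Finset.mul_sum]
    refine Finset.sum_congr rfl fun a _ => ?_
    rw [Finset.mul_sum, Finset.mul_sum]
    exact Finset.sum_congr rfl fun ty _ => by ring
  have t : ∑' k, δ ^ (k + 1) * G.expStage i (k + 1) s σ =
      ∑ a : I → B, ∑ ty : S × Y, ((∏ j, (σ j [] : B → ℝ) (a j)) * G.p s a ty * δ) *
        ∑' k, (δ ^ k * G.expStage i k ty.1 (contProfile σ a ty)) := by
    simp only [e]
    rw [Summable.tsum_finsetSum]
    · refine Finset.sum_congr rfl fun a _ => ?_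
      rw [Summable.tsum_finsetSum]
      · exact Finset.sum_congr rfl fun ty _ => tsum_mul_left
      · exact fun ty _ => (G.summable_expStage h0 h1 _ _ _).mul_left _
    · exact fun a _ => summable_sum fun ty _ => (G.summable_expStage h0 h1 _ _ _).mul_left _
  rw [payoff, hs.tsum_eq_zero_add, t, pow_zero, one_mul, mul_add, mixExp]
  simp only [oneShot, mul_add, Finset.sum_add_distrib]
  congr 1
  · change _ * mixExp _ _ = _
    rw [mixExp, Finset.mul_sum]
    exact Finset.sum_congr rfl fun a _ => by ring
  · rw [Finset.mul_sum]
    refine Finset.sum_congr rfl fun a _ => ?_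
    rw [Finset.mul_sum, Finset.mul_sum, Finset.mul_sum]
    refine Finset.sum_congr rfl fun ty _ => ?_
    simp only [payoff]
    ring

theorem payoff_public_eq (G : StochasticGame I S B Y) {δ : ℝ} (h0 : 0 < δ) (h1 : δ < 1)
    (i : I) (s : S) (σ : I → PublicStrategy S B Y) :
    G.payoff δ i s (fun j => (σ j).toStrategy) = mixExp (fun j => σ j [])
      (G.oneShot δ i s fun t y =>
        G.payoff δ i t (fun j => ((σ j).after [(y, t)]).toStrategy)) := by
  rw [G.payoff_eq h0 h1]
  rfl

theorem oneShot_mono (G : StochasticGame I S B Y) {δ : ℝ} (h0 : 0 < δ) (i : I) (s : S)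
    (a : I → B) {w w' : S → Y → ℝ} (h : ∀ t y, w t y ≤ w' t y) :
    G.oneShot δ i s w a ≤ G.oneShot δ i s w' a := by
  unfold oneShot
  have : ∑ ty : S × Y, G.p s a ty * w ty.1 ty.2 ≤ ∑ ty : S × Y, G.p s a ty * w' ty.1 ty.2 :=
    Finset.sum_le_sum fun ty _ => mul_le_mul_of_nonneg_left (h _ _) (G.p_nonneg s a ty)
  have := mul_le_mul_of_nonneg_left this h0.le
  linarith

theorem oneShot_add_const (G : StochasticGame I S B Y) (δ : ℝ) (i : I) (s : S)
    (a : I → B) (w : S → Y → ℝ) (c : ℝ) :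
    G.oneShot δ i s (fun t y => w t y + c) a = G.oneShot δ i s w a + δ * c := by
  unfold oneShot
  simp only [mul_add, Finset.sum_add_distrib, ← Finset.sum_mul, G.p_sum]
  ring

theorem le_of_forall_le_add_pow {δ a b D : ℝ} (h0 : 0 < δ) (h1 : δ < 1)
    (h : ∀ n : ℕ, a ≤ b + δ ^ n * D) : a ≤ b := by
  have ht : Filter.Tendsto (fun n : ℕ => b + δ ^ n * D) Filter.atTop (nhds (b + 0 * D)) :=
    ((tendsto_pow_atTop_nhds_zero_of_lt_one h0.le h1).mul_const D).const_add b
  simpa using ge_of_tendsto' ht h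

/-- The deviator's continuation remembers the private action `a i`, yet it is again an arbitrary
strategy against public continuations, so inductions over all `τ` close. -/
theorem contProfile_update (σ : I → PublicStrategy S B Y) (h : List (Y × S)) (i : I)
    (τ : Strategy S B Y) (a : I → B) (t : S) (y : Y) :
    contProfile (Function.update (fun j => ((σ j).after h).toStrategy) i τ) a (t, y) =
      Function.update (fun j => ((σ j).after (h ++ [(y, t)])).toStrategy) i
        (fun l => τ ((a i, y, t) :: l)) := by
  funext j l
  by_cases hj : j = i
  · subst hj
    simp [contProfile]
  · simp [contProfile, Function.update_of_ne hj, PublicStrategy.toStrategy, PublicStrategy.after]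

/-- If no one-shot deviation gains against the continuation values `w`, no deviation at all does. -/
theorem payoff_update_le [DecidableEq B] (G : StochasticGame I S B Y) {δ : ℝ} (h0 : 0 < δ)
    (h1 : δ < 1) (i : I) (s₀ : S) (σ : I → PublicStrategy S B Y) (w : List (Y × S) → ℝ) {D : ℝ}
    (hw : ∀ h, |w h| ≤ D)
    (hσ : ∀ h b, mixExp (Function.update (fun j => σ j h) i (pureAction b))
      (G.oneShot δ i (currentState s₀ h) fun t y => w (h ++ [(y, t)])) ≤ w h)
    (h : List (Y × S)) (τ : Strategy S B Y) :
    G.payoff δ i (currentState s₀ h)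
      (Function.update (fun j => ((σ j).after h).toStrategy) i τ) ≤ w h := by
  -- The crude error `payoffBound + D` at horizon zero shrinks by a factor `δ` with each unrolled
  -- period.
  refine le_of_forall_le_add_pow h0 h1 (D := G.payoffBound + D) fun n => ?_
  induction n generalizing h τ with
  | zero =>
    have := (abs_le.1 (G.abs_payoff_le h0 h1 i (currentState s₀ h)
      (Function.update (fun j => ((σ j).after h).toStrategy) i τ))).2
    have := (abs_le.1 (hw h)).1
    simp only [pow_zero, one_mul]
    linarith
  | succ n ih =>
    rw [G.payoff_eq h0 h1]
    have e : (fun j => Function.update (fun j => ((σ j).after h).toStrategy) i τ j []) =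
        Function.update (fun j => σ j h) i (τ []) := by
      funext j
      by_cases hj : j = i
      · subst hj; simp
      · simp [Function.update_of_ne hj, PublicStrategy.toStrategy, PublicStrategy.after]
    rw [e]
    calc _ ≤ mixExp (Function.update (fun j => σ j h) i (τ []))
          (G.oneShot δ i (currentState s₀ h) fun t y =>
            w (h ++ [(y, t)]) + δ ^ n * (G.payoffBound + D)) := by
          refine mixExp_mono _ fun a => G.oneShot_mono h0 _ _ _ fun t y => ?_
          rw [contProfile_update]
          have := ih (h ++ [(y, t)]) (fun l => τ ((a i, y, t) :: l))
          rwa [currentState_append] at this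
      _ = mixExp (Function.update (fun j => σ j h) i (τ []))
          (G.oneShot δ i (currentState s₀ h) fun t y => w (h ++ [(y, t)])) +
            δ ^ (n + 1) * (G.payoffBound + D) := by
          rw [show G.oneShot δ i (currentState s₀ h) (fun t y =>
            w (h ++ [(y, t)]) + δ ^ n * (G.payoffBound + D)) = _ from
              funext fun a => G.oneShot_add_const _ _ _ _ _ _, mixExp_add, mixExp_const]
          ring
      _ ≤ _ := by
          have := mixExp_update_le _ i (τ []) _ (hσ h)
          linarith

/-- The same iteration along the path of `σ`, with the inequality reversed. -/
theorem le_payoff_after (G : StochasticGame I S B Y) {δ : ℝ} (h0 : 0 < δ)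
    (h1 : δ < 1) (i : I) (s₀ : S) (σ : I → PublicStrategy S B Y) (w : List (Y × S) → ℝ) {D : ℝ}
    (hw : ∀ h, |w h| ≤ D)
    (hσ : ∀ h, w h ≤ mixExp (fun j => σ j h)
      (G.oneShot δ i (currentState s₀ h) fun t y => w (h ++ [(y, t)])))
    (h : List (Y × S)) :
    w h ≤ G.payoff δ i (currentState s₀ h) (fun j => ((σ j).after h).toStrategy) := by
  refine le_of_forall_le_add_pow h0 h1 (D := G.payoffBound + D) fun n => ?_
  induction n generalizing h with
  | zero =>
    have := (abs_le.1 (G.abs_payoff_le h0 h1 i (currentState s₀ h)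
      (fun j => ((σ j).after h).toStrategy))).1
    have := (abs_le.1 (hw h)).2
    simp only [pow_zero, one_mul]
    linarith
  | succ n ih =>
    have e : (fun j => (σ j).after h []) = fun j => σ j h := by
      funext j; simp [PublicStrategy.after]
    rw [G.payoff_public_eq h0 h1, e]
    calc w h ≤ _ := hσ h
      _ ≤ mixExp (fun j => σ j h) (G.oneShot δ i (currentState s₀ h) fun t y =>
            G.payoff δ i t (fun j => (((σ j).after h).after [(y, t)]).toStrategy) +
              δ ^ n * (G.payoffBound + D)) := by
          refine mixExp_mono _ fun a => G.oneShot_mono h0 _ _ _ fun t y => ?_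
          have := ih (h ++ [(y, t)])
          rw [currentState_append] at this
          simpa only [PublicStrategy.after_after] using this
      _ = _ := by
          rw [show G.oneShot δ i (currentState s₀ h) (fun t y =>
            G.payoff δ i t (fun j => (((σ j).after h).after [(y, t)]).toStrategy) +
              δ ^ n * (G.payoffBound + D)) = _ from
              funext fun a => G.oneShot_add_const _ _ _ _ _ _, mixExp_add, mixExp_const]
          ring

/-- Continuation values that are bounded, generated by `σ`, and deter one-shot deviations are the
payoffs of a perfect public equilibrium. -/
theorem isPPE_of_oneShot [DecidableEq B] (G : StochasticGame I S B Y) {δ : ℝ} (h0 : 0 < δ)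
    (h1 : δ < 1) (s₀ : S) (σ : I → PublicStrategy S B Y) (w : List (Y × S) → ℝ) {D : ℝ}
    (hw : ∀ h, |w h| ≤ D)
    (hval : ∀ h i, mixExp (fun j => σ j h)
      (G.oneShot δ i (currentState s₀ h) fun t y => w (h ++ [(y, t)])) = w h)
    (hinc : ∀ h i b, mixExp (Function.update (fun j => σ j h) i (pureAction b))
      (G.oneShot δ i (currentState s₀ h) fun t y => w (h ++ [(y, t)])) ≤ w h) :
    G.IsPPE δ s₀ σ ∧ ∀ i, G.payoff δ i s₀ (fun j => (σ j).toStrategy) = w [] := by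
  have hup := fun i => G.payoff_update_le h0 h1 i s₀ σ w hw (fun h b => hinc h i b)
  have hlo := fun i => G.le_payoff_after h0 h1 i s₀ σ w hw (fun h => (hval h i).ge)
  refine ⟨fun h i τ => (hup i h τ).trans (hlo i h), fun i => le_antisymm ?_ (hlo i [])⟩
  -- A player's own strategy counts as a deviation, so the deviation bound also caps the equilibrium
  -- payoff.
  have := hup i [] ((σ i).toStrategy)
  rwa [Function.update_eq_self_iff.2 (by rfl)] at this

end StochasticGame

/-! ### Potentials for weighted digraphs without positive cycles. -/

section potential

variable {S : Type*}

/-- Total weight of the consecutive pairs in a list. -/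
def walkWeight (m : S → S → ℝ) (l : List S) : ℝ := (List.zipWith m l l.tail).sum

theorem walkWeight_cons_cons (m : S → S → ℝ) (s t : S) (l : List S) :
    walkWeight m (s :: t :: l) = m s t + walkWeight m (t :: l) := by
  simp [walkWeight]

theorem walkWeight_append (m : S → S → ℝ) (l₁ : List S) (s : S) (l₂ : List S) :
    walkWeight m (l₁ ++ s :: l₂) = walkWeight m (l₁ ++ [s]) + walkWeight m (s :: l₂) := by
  induction l₁ with
  | nil => simp [walkWeight]
  | cons a l ih =>
    cases l with
    | nil => simp [walkWeight]
    | cons b l =>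
      simp only [List.cons_append, walkWeight_cons_cons] at ih ⊢
      rw [ih, add_assoc]

/-- The simple cycle is the permutation `List.formPerm` of its vertex list, restricted to the set of
vertices, so `hm` applies to it. -/
theorem walkWeight_cycle_le [DecidableEq S] (m : S → S → ℝ)
    (hm : ∀ (T : Finset S) (ξ : Equiv.Perm T), ∑ s : T, m s (ξ s) ≤ 0)
    (s : S) (l : List S) (hl : (s :: l).Nodup) : walkWeight m (s :: (l ++ [s])) ≤ 0 := by
  set c := s :: l with hc
  have hrot : c.map c.formPerm = l ++ [s] := by
    have : l ++ [s] = c.rotate 1 := by simp [hc]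
    rw [this]
    refine List.ext_getElem (by simp) fun n h₁ h₂ => ?_
    rw [List.getElem_map, List.formPerm_apply_getElem _ hl, List.getElem_rotate]
  have hmem : ∀ x, x ∈ c.toFinset ↔ c.formPerm x ∈ c.toFinset := by
    intro x
    simp only [List.mem_toFinset]
    exact List.formPerm_mem_iff_mem.symm
  have h := hm c.toFinset (c.formPerm.subtypePerm fun x => (hmem x).symm)
  have e : ∑ x : c.toFinset, m x ((c.formPerm.subtypePerm fun x => (hmem x).symm) x) =
      ∑ x ∈ c.toFinset, m x (c.formPerm x) := by
    rw [← Finset.sum_coe_sort c.toFinset]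
    rfl
  rw [e, List.sum_toFinset _ hl] at h
  have hz : walkWeight m (s :: (l ++ [s])) = (c.map fun x => m x (c.formPerm x)).sum := by
    rw [walkWeight, List.tail_cons, ← List.cons_append, ← hc]
    rw [← hrot]
    congr 1
    refine List.ext_getElem (by simp) fun n h₁ h₂ => ?_
    simp only [List.length_map] at h₂
    simp [List.getElem_append_left h₂]
  rw [hz]
  exact h

/-- A weighted digraph on a finite set without positive simple cycles has a potential. -/
theorem exists_potential [Finite S] (m : S → S → ℝ)
    (hm : ∀ (T : Finset S) (ξ : Equiv.Perm T), ∑ s : T, m s (ξ s) ≤ 0) :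
    ∃ θ : S → ℝ, ∀ s t, m s t + θ t ≤ θ s := by
  classical
  have := Fintype.ofFinite S
  have hfin : ∀ s, {l : List S | (s :: l).Nodup}.Finite := by
    intro s
    refine Set.Finite.subset (s := {l : List S | l.Nodup}) ?_ fun l hl => (List.nodup_cons.1 hl).2
    exact Set.finite_coe_iff.1 (inferInstanceAs (Finite {l : List S // l.Nodup}))
  have hmax : ∀ s, ∃ l, (s :: l).Nodup ∧
      ∀ l', (s :: l').Nodup → walkWeight m (s :: l') ≤ walkWeight m (s :: l) := fun s =>
    Set.exists_max_image _ (fun l => walkWeight m (s :: l)) (hfin s) ⟨[], List.nodup_singleton s⟩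
  choose P hP hPmax using hmax
  -- The potential at `s` is the largest weight of a simple path starting at `s`; finiteness of the
  -- set of such paths gives the maximum.
  refine ⟨fun s => walkWeight m (s :: P s), fun s t => ?_⟩
  by_cases hs : s ∈ t :: P t
  -- The best path from `t` returns to `s`: prepending `s` closes a cycle of nonpositive weight, and
  -- what remains is a simple path from `s`.
  · obtain ⟨l₁, l₂, e⟩ := List.append_of_mem hs
    have hnd : (l₁ ++ s :: l₂).Nodup := e ▸ hP t
    have hsl₂ : (s :: l₂).Nodup := (List.nodup_append.1 hnd).2.1
    have hsl₁ : (s :: l₁).Nodup := by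
      rw [List.nodup_middle] at hnd
      exact hnd.sublist (by simp)
    have h2 := hPmax s l₂ hsl₂
    have h1 := walkWeight_cycle_le m hm s l₁ hsl₁
    have h3 : m s t + walkWeight m (l₁ ++ [s]) = walkWeight m (s :: (l₁ ++ [s])) := by
      cases l₁ with
      | nil =>
        obtain ⟨rfl, -⟩ := List.cons.inj e
        rfl
      | cons a l =>
        obtain ⟨rfl, -⟩ := List.cons.inj e
        rfl
    simp only
    rw [e, walkWeight_append]
    linarith
  · rw [← walkWeight_cons_cons]
    exact hPmax s (t :: P t) (List.nodup_cons.2 ⟨hs, hP t⟩)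

/-- Transfers whose sums over cycles are never positive are dominated by potential differences. -/
theorem exists_potential_of_transfers [Finite S] {Y : Type*} [Finite Y] [Nonempty Y]
    (x : S → S → Y → ℝ)
    (hx : ∀ (T : Finset S) (ξ : Equiv.Perm T) (ψ : T → Y), ∑ s : T, x s (ξ s) (ψ s) ≤ 0) :
    ∃ θ : S → ℝ, ∀ s t y, x s t y + θ t ≤ θ s := by
  -- Only the signal with the largest transfer matters for each pair of states.
  choose Ψ hΨ using fun s t => Finite.exists_max (x s t)
  obtain ⟨θ, hθ⟩ := exists_potential (fun s t => x s t (Ψ s t))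
    fun T ξ => hx T ξ fun s => Ψ s (ξ s)
  exact ⟨θ, fun s t y => by linarith [hΨ s t y, hθ s t]⟩

end potential

/-! ### Common payoffs and decomposition of strongly symmetric equilibria. -/

namespace StochasticGame

variable {I S B Y : Type*} [Fintype I] [DecidableEq I] [Fintype S] [Fintype B] [Fintype Y]

/-- Transposing `i` and `j` leaves the product weights of a symmetric profile unchanged. -/
theorem uMix_eq_of_isSymmetric (G : StochasticGame I S B Y) (hG : G.IsSymmetric) (i j : I) (s : S)
    (α : MixedAction B) : G.uMix i s (fun _ => α) = G.uMix j s (fun _ => α) := by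
  let τ : Equiv.Perm I := Equiv.swap i j
  have hτ : ∀ a, G.u i s a = G.u j s (a ∘ τ.symm) := fun a => by
    rw [← ((hG τ s a).1 i), show τ i = j from Equiv.swap_apply_left i j]
  unfold uMix
  refine Fintype.sum_equiv (Equiv.arrowCongr τ (Equiv.refl B)) _ _ fun a => ?_
  change _ = (∏ k, (α : B → ℝ) (a (τ.symm k))) * G.u j s (a ∘ τ.symm)
  rw [hτ, Equiv.prod_comp τ.symm fun k => (α : B → ℝ) (a k)]

theorem payoff_eq_of_isSymmetric (G : StochasticGame I S B Y) (hG : G.IsSymmetric) (δ : ℝ)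
    (i j : I) (s : S) (σ : I → PublicStrategy S B Y) (hσ : ∀ i j h, σ i h = σ j h) :
    G.payoff δ i s (fun j => (σ j).toStrategy) = G.payoff δ j s (fun j => (σ j).toStrategy) := by
  have e : σ = fun _ => σ i := funext fun j => funext fun h => hσ j i h
  have key : ∀ (k : ℕ) (s : S) (σ : PublicStrategy S B Y),
      G.expStage i k s (fun _ => σ.toStrategy) = G.expStage j k s (fun _ => σ.toStrategy) := by
    intro k
    induction k with
    | zero => exact fun s σ => G.uMix_eq_of_isSymmetric hG i j s (σ [])
    | succ k ih =>
      intro s σ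
      rw [expStage_succ, expStage_succ]
      congr 1
      funext a
      exact Finset.sum_congr rfl fun ty _ => congrArg _ (ih ty.1 (σ.after [(ty.2, ty.1)]))
  rw [e]
  simp only [payoff, key]

theorem IsSSE.after {G : StochasticGame I S B Y} {δ : ℝ} {s : S} {σ : I → PublicStrategy S B Y}
    (hσ : G.IsSSE δ s σ) (h : List (Y × S)) :
    G.IsSSE δ (currentState s h) (fun i => (σ i).after h) := by
  refine ⟨fun h' => ?_, fun i j l => hσ.2 i j _⟩
  have := hσ.1 (h ++ h')
  rw [← currentState_currentState_append] at this
  simpa only [PublicStrategy.after_after] using this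

/-- Payoffs of strongly symmetric equilibria that only use mixed actions in `A`. -/
def sseSetIn (G : StochasticGame I S B Y) (A : Set (MixedAction B)) (δ : ℝ) (s : S) : Set ℝ :=
  {v | ∃ σ : I → PublicStrategy S B Y, G.IsSSE δ s σ ∧ (∀ i h, σ i h ∈ A) ∧
    ∀ i, G.payoff δ i s (fun j => (σ j).toStrategy) = v}

theorem abs_le_of_mem_sseSetIn [Nonempty I] (G : StochasticGame I S B Y)
    {A : Set (MixedAction B)} {δ : ℝ} (h0 : 0 < δ) (h1 : δ < 1) {s : S} {v : ℝ}
    (hv : v ∈ G.sseSetIn A δ s) : |v| ≤ G.payoffBound := by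
  obtain ⟨σ, -, -, hσ⟩ := hv
  rw [← hσ (Classical.arbitrary I)]
  exact G.abs_payoff_le h0 h1 _ _ _

variable [DecidableEq B]

/-- Turns a pure deviation in the first period only into a legitimate strategy, so that the Nash
property yields the one-shot incentive constraint. -/
theorem payoff_oneShot_deviation (G : StochasticGame I S B Y) {δ : ℝ} (h0 : 0 < δ) (h1 : δ < 1)
    (i : I) (s : S) (σ : I → PublicStrategy S B Y) (b : B) :
    G.payoff δ i s (Function.update (fun j => (σ j).toStrategy) i
        fun l => if l = [] then pureAction b else (σ i).toStrategy l) =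
      mixExp (Function.update (fun j => σ j []) i (pureAction b))
        (G.oneShot δ i s fun t y =>
          G.payoff δ i t (fun j => ((σ j).after [(y, t)]).toStrategy)) := by
  rw [G.payoff_eq h0 h1]
  congr 1
  · funext j
    by_cases hj : j = i
    · subst hj; simp
    · simp [Function.update_of_ne hj, PublicStrategy.toStrategy]
  · funext a
    congr 1
    funext t y
    have := contProfile_update σ [] i
      (fun l => if l = [] then pureAction b else (σ i).toStrategy l) a t y
    simp only [PublicStrategy.after_nil] at this
    rw [this, Function.update_eq_self_iff.2]
    · rfl
    · funext l
      simp [PublicStrategy.toStrategy, PublicStrategy.after]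

/-- The payoff of a strongly symmetric equilibrium is generated by continuation payoffs of
strongly symmetric equilibria. -/
theorem exists_decomposition [Nonempty I] (G : StochasticGame I S B Y) (hG : G.IsSymmetric)
    {A : Set (MixedAction B)} {δ : ℝ} (h0 : 0 < δ) (h1 : δ < 1) {s : S} {v : ℝ}
    (hv : v ∈ G.sseSetIn A δ s) :
    ∃ α ∈ A, ∃ w : S → Y → ℝ, (∀ t y, w t y ∈ G.sseSetIn A δ t) ∧
      (∀ i, mixExp (fun _ => α) (G.oneShot δ i s w) = v) ∧
      ∀ i b, mixExp (Function.update (fun _ => α) i (pureAction b)) (G.oneShot δ i s w) ≤ v := by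
  obtain ⟨σ, hσ, hA, hval⟩ := hv
  let i₀ : I := Classical.arbitrary I
  let w : S → Y → ℝ := fun t y => G.payoff δ i₀ t (fun j => ((σ j).after [(y, t)]).toStrategy)
  have hw : ∀ i t y, G.payoff δ i t (fun j => ((σ j).after [(y, t)]).toStrategy) = w t y :=
    fun i t y => G.payoff_eq_of_isSymmetric hG δ i i₀ t (fun j => (σ j).after [(y, t)])
      fun i j l => hσ.2 i j _
  have hα : (fun j => σ j []) = fun _ => σ i₀ [] := funext fun j => hσ.2 j i₀ []
  refine ⟨σ i₀ [], hA _ _, w, fun t y => ?_, fun i => ?_, fun i b => ?_⟩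
  · exact ⟨_, hσ.after [(y, t)], fun i h => hA _ _, fun i => hw i t y⟩
  · rw [← hval i, G.payoff_public_eq h0 h1, hα]
    simp only [hw]
  · have h := hσ.1 [] i (fun l => if l = [] then pureAction b else (σ i).toStrategy l)
    have hd := G.payoff_oneShot_deviation h0 h1 i s σ b
    simp only [hα, hw] at hd
    rw [← hd, ← hval i]
    exact h

/-! ### The scores bound equilibrium payoffs. -/

/-- The score in direction `l` when the actions are required to lie in `A`. -/
def scoreIn (G : StochasticGame I S B Y) (A : Set (MixedAction B)) (l : ℝ) : EReal :=
  sSup {r | ∃ α v x, (∀ s, α s ∈ A) ∧ G.Feasible l α v x ∧ r = ((l * v : ℝ) : EReal)}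

/-- Feasibility restated through the one-shot game with continuation values
`w - c * (v - w) + c * x`, where `c = (1 - δ) / δ`. -/
theorem mixExp_oneShot_transfer (G : StochasticGame I S B Y) {δ : ℝ} (h0 : 0 < δ) (i : I) (s : S)
    (x : S → Y → ℝ) (v w : ℝ) (α : I → MixedAction B) :
    mixExp α (G.oneShot δ i s fun t y =>
        w - (1 - δ) / δ * (v - w) + (1 - δ) / δ * x t y) =
      w + (1 - δ) * (G.uMix i s α + ∑ ty : S × Y, x ty.1 ty.2 * G.pMix s α ty - v) := by
  rw [mixExp_oneShot]
  simp only [add_mul, Finset.sum_add_distrib, ← Finset.mul_sum, mul_assoc, G.pMix_sum]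
  field_simp
  ring

/-- For every `η > 0` the value `v - l * η` is feasible; the slack `η` pays for extremal payoffs
that need not be attained. -/
theorem score_ge_of_mem [Nonempty I] (G : StochasticGame I S B Y) (hG : G.IsSymmetric)
    (A : Set (MixedAction B)) {δ : ℝ} (h0 : 0 < δ) (h1 : δ < 1) {l : ℝ} (hl : l * l = 1) {v : ℝ}
    (hv : ∀ s, v ∈ G.sseSetIn A δ s) : ((l * v : ℝ) : EReal) ≤ G.scoreIn A l := by
  have h1' : 0 < 1 - δ := by linarith
  refine EReal.ge_of_forall_gt_iff_ge.1 fun r hr => ?_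
  rw [EReal.coe_lt_coe_iff] at hr
  obtain ⟨η, hη, hηr⟩ : ∃ η > 0, r = l * v - η := ⟨l * v - r, by linarith, by ring⟩
  let W : S → ℝ := fun s => sSup ((l * ·) '' G.sseSetIn A δ s)
  have hbdd : ∀ s, BddAbove ((l * ·) '' G.sseSetIn A δ s) := fun s => by
    refine ⟨|l| * G.payoffBound, ?_⟩
    rintro _ ⟨z, hz, rfl⟩
    refine (le_abs_self _).trans ?_
    rw [abs_mul]
    exact mul_le_mul_of_nonneg_left (G.abs_le_of_mem_sseSetIn h0 h1 hz) (abs_nonneg l)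
  have hW : ∀ s, ∀ z ∈ G.sseSetIn A δ s, l * z ≤ W s := fun s z hz =>
    le_csSup (hbdd s) ⟨z, hz, rfl⟩
  have hex : ∀ s, ∃ z ∈ G.sseSetIn A δ s, W s - (1 - δ) * η < l * z := fun s => by
    obtain ⟨_, ⟨z, hz, rfl⟩, h⟩ := exists_lt_of_lt_csSup (s := (l * ·) '' G.sseSetIn A δ s)
      ⟨_, v, hv s, rfl⟩ (show W s - (1 - δ) * η < W s by nlinarith)
    exact ⟨z, hz, h⟩
  choose z hz hzW using hex
  choose α hα w hw hval hinc using fun s => G.exists_decomposition hG h0 h1 (hz s)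
  -- The first term rescales continuation values; the remaining constants make every state, whatever
  -- its own `z s`, yield the common value `v - l * η`.
  let x : S → S → Y → ℝ := fun s t y => δ / (1 - δ) * (w s t y - z s) + (v - z s) - l * η
  have hsum : ∀ s i (β : I → MixedAction B),
      G.uMix i s β + ∑ ty : S × Y, x s ty.1 ty.2 * G.pMix s β ty =
        v - l * η + (mixExp β (G.oneShot δ i s (w s)) - z s) / (1 - δ) := by
    intro s i β
    rw [mixExp_oneShot]
    have : ∑ ty : S × Y, x s ty.1 ty.2 * G.pMix s β ty =
        δ / (1 - δ) * (∑ ty : S × Y, w s ty.1 ty.2 * G.pMix s β ty) +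
          (-(δ / (1 - δ)) * z s + (v - z s) - l * η) * ∑ ty, G.pMix s β ty := by
      rw [Finset.mul_sum, Finset.mul_sum, ← Finset.sum_add_distrib]
      exact Finset.sum_congr rfl fun ty _ => by simp only [x]; ring
    rw [this, G.pMix_sum]
    field_simp
    ring
  refine le_sSup ⟨α, v - l * η, x, hα, ⟨fun s i => ?_, fun s i b => ?_, fun T ξ ψ => ?_⟩, ?_⟩
  · rw [hsum, hval]
    ring
  · rw [hsum]
    have := div_nonpos_of_nonpos_of_nonneg (sub_nonpos.2 (hinc s i b)) h1'.le
    linarith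
  · rw [Finset.mul_sum]
    have hterm : ∀ s : T, l * x s (ξ s) (ψ s) ≤ δ / (1 - δ) * (W (ξ s) - W s) := by
      intro s
      have a1 := hW _ _ (hw s (ξ s) (ψ s))
      have a2 := hzW s
      have a3 := hW _ _ (hv s)
      have hd : 0 ≤ δ / (1 - δ) := by positivity
      have e : l * x s (ξ s) (ψ s) = δ / (1 - δ) * (l * w s (ξ s) (ψ s) - l * z s) +
          (l * v - l * z s) - (l * l) * η := by
        simp only [x]; ring
      rw [e, hl]
      -- The near-optimality error `(1 - δ) * η` costs `δ * η` here and `(1 - δ) * η` in `l * v - l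
      -- * z s`; together they exactly use up `η`.
      have b1 : δ / (1 - δ) * (l * w s (ξ s) (ψ s) - l * z s) ≤
          δ / (1 - δ) * (W (ξ s) - W s + (1 - δ) * η) :=
        mul_le_mul_of_nonneg_left (by linarith) hd
      have b2 : δ / (1 - δ) * (W (ξ s) - W s + (1 - δ) * η) =
          δ / (1 - δ) * (W (ξ s) - W s) + δ * η := by
        field_simp
      linarith
    calc _ ≤ ∑ s : T, δ / (1 - δ) * (W (ξ s) - W s) := Finset.sum_le_sum fun s _ => hterm s
      _ = 0 := by
        rw [← Finset.mul_sum, Finset.sum_sub_distrib,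
          Equiv.sum_comp ξ fun s : T => W s, sub_self, mul_zero]
  · rw [hηr, mul_sub, ← mul_assoc, hl, one_mul]

/-! ### Equilibria driven by a promised payoff. -/

theorem exists_feasible_of_lt_scoreIn (G : StochasticGame I S B Y) {A : Set (MixedAction B)}
    {l r : ℝ} (h : (r : EReal) < G.scoreIn A l) :
    ∃ α v x, (∀ s, α s ∈ A) ∧ G.Feasible l α v x ∧ r < l * v := by
  obtain ⟨_, ⟨α, v, x, hA, hf, rfl⟩, hr⟩ := lt_sSup_iff.1 h
  exact ⟨α, v, x, hA, hf, EReal.coe_lt_coe_iff.1 hr⟩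

section construction

variable (α α' : S → MixedAction B) (v v' : ℝ) (x x' : S → S → Y → ℝ) (z c : ℝ)

/-- Update of the promised payoff and the state: the data `(v, x)` are used while the promise is at
least `z`, and `(v', x')` while it is below `z`. -/
def promiseStep (q : ℝ × S) (o : Y × S) : ℝ × S :=
  (if z ≤ q.1 then q.1 - c * (v - q.1) + c * x q.2 o.2 o.1
    else q.1 - c * (v' - q.1) + c * x' q.2 o.2 o.1, o.2)

/-- Promised payoff and state after a public history. -/
def promise (s₀ : S) (h : List (Y × S)) : ℝ × S :=
  h.foldl (promiseStep v v' x x' z c) (z, s₀)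

/-- The common public strategy driven by the promised payoff. -/
def promiseStrategy (s₀ : S) : PublicStrategy S B Y := fun h =>
  if z ≤ (promise v v' x x' z c s₀ h).1 then α (promise v v' x x' z c s₀ h).2
    else α' (promise v v' x x' z c s₀ h).2

theorem promise_append (s₀ : S) (h : List (Y × S)) (o : Y × S) :
    promise v v' x x' z c s₀ (h ++ [o]) =
      promiseStep v v' x x' z c (promise v v' x x' z c s₀ h) o := by
  simp [promise]

theorem promise_snd (s₀ : S) (h : List (Y × S)) :
    (promise v v' x x' z c s₀ h).2 = currentState s₀ h := by
  rcases List.eq_nil_or_concat h with rfl | ⟨l, ⟨y, t⟩, rfl⟩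
  · simp [currentState, promise]
  · rw [List.concat_eq_append, currentState_append, promise_append]
    rfl

variable {v v' x x' z c}

/-- Promises drift back to `z`: their distance to `z` is of the order of `c`. -/
theorem promise_bounds {θ θ' : S → ℝ} {X Θ K : ℝ} (hc : 0 ≤ c)
    (hx : ∀ s t y, x s t y + θ t ≤ θ s) (hx' : ∀ s t y, θ' s ≤ x' s t y + θ' t)
    (hX : ∀ s t y, |x s t y| ≤ X) (hX' : ∀ s t y, |x' s t y| ≤ X)
    (hΘ : ∀ s, |θ s| ≤ Θ) (hΘ' : ∀ s, |θ' s| ≤ Θ) (hX0 : 0 ≤ X) (hv : v' ≤ z) (hv' : z ≤ v)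
    (hK : X + (v - v') + Θ ≤ K) (hz : z + c * (K + Θ) ≤ v) (hz' : v' ≤ z - c * (K + Θ))
    (s₀ : S) (h : List (Y × S)) :
    (promise v v' x x' z c s₀ h).1 ≤ z + c * (K + Θ) ∧
      z - c * (K + Θ) ≤ (promise v v' x x' z c s₀ h).1 := by
  have hpot : ∀ s, c * θ s ≤ c * Θ ∧ -(c * Θ) ≤ c * θ s := fun s => by
    have := abs_le.1 (hΘ s); constructor <;> nlinarith
  have hpot' : ∀ s, c * θ' s ≤ c * Θ ∧ -(c * Θ) ≤ c * θ' s := fun s => by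
    have := abs_le.1 (hΘ' s); constructor <;> nlinarith
  have hK' : c * X + c * (v - v') + c * Θ ≤ c * K := by
    have := mul_le_mul_of_nonneg_left hK hc; linarith
  have hcX : 0 ≤ c * X := mul_nonneg hc hX0
  have hcv : 0 ≤ c * (v - v') := mul_nonneg hc (by linarith)
  have extract : ∀ q : ℝ × S, q.1 + c * θ q.2 ≤ z + c * K ∧ z - c * K ≤ q.1 + c * θ' q.2 →
      q.1 ≤ z + c * (K + Θ) ∧ z - c * (K + Θ) ≤ q.1 := fun q hq => by
    have a := hpot q.2
    have b := hpot' q.2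
    constructor <;> linarith
  -- The invariant is stated for `q.1 + c * θ q.2` and `q.1 + c * θ' q.2`, since `q.1` alone need
  -- not be monotone within a regime.
  refine extract _ ?_
  induction h using List.reverseRecOn with
  | nil =>
    have a := hpot s₀
    have b := hpot' s₀
    constructor <;> simp only [promise, List.foldl_nil] <;> linarith
  | append_singleton l o ih =>
    rw [promise_append]
    generalize promise v v' x x' z c s₀ l = q at ih ⊢
    obtain ⟨w, s⟩ := q
    obtain ⟨y, t⟩ := o
    have hq := extract _ ih
    have a := hpot t
    have b := hpot' t
    simp only [promiseStep] at ih hq ⊢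
    -- In each regime one bound is inherited through the potential, because `v' ≤ w ≤ v`; the other
    -- holds because a single step from the near side of `z` moves by at most `c * K`, potential
    -- included.
    by_cases hwz : z ≤ w
    · simp only [if_pos hwz]
      have e₁ := mul_le_mul_of_nonneg_left (hx s t y) hc
      have e₂ : 0 ≤ c * (v - w) := mul_nonneg hc (by linarith)
      have e₃ : c * (v - w) ≤ c * (v - v') := mul_le_mul_of_nonneg_left (by linarith) hc
      have e₄ := mul_le_mul_of_nonneg_left (abs_le.1 (hX s t y)).1 hc
      constructor <;> linarith
    · simp only [if_neg hwz]
      have e₁ := mul_le_mul_of_nonneg_left (hx' s t y) hc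
      have e₂ : 0 ≤ c * (w - v') := mul_nonneg hc (by linarith)
      have e₃ : c * (w - v') ≤ c * (v - v') := mul_le_mul_of_nonneg_left (by linarith) hc
      have e₄ := mul_le_mul_of_nonneg_left (abs_le.1 (hX' s t y)).2 hc
      constructor <;> linarith

end construction

/-- Promises satisfy the one-shot value and incentive conditions by construction in either regime,
so boundedness is all that is left to require. -/
theorem mem_sseSetIn_of_promise_bounded (G : StochasticGame I S B Y) {A : Set (MixedAction B)}
    {α α' : S → MixedAction B} {v v' : ℝ} {x x' : S → S → Y → ℝ} (hα : ∀ s, α s ∈ A)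
    (hα' : ∀ s, α' s ∈ A) {l l' : ℝ} (hf : G.Feasible l α v x) (hf' : G.Feasible l' α' v' x')
    {δ : ℝ} (h0 : 0 < δ) (h1 : δ < 1) {z D : ℝ} (s₀ : S)
    (hD : ∀ h, |(promise v v' x x' z ((1 - δ) / δ) s₀ h).1| ≤ D) :
    z ∈ G.sseSetIn A δ s₀ := by
  set c := (1 - δ) / δ with hc
  let w : List (Y × S) → ℝ := fun h => (promise v v' x x' z c s₀ h).1
  let σ : PublicStrategy S B Y := promiseStrategy α α' v v' x x' z c s₀
  have h1' : 0 ≤ 1 - δ := by linarith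
  have hσA : ∀ h, σ h ∈ A := fun h => by
    simp only [σ, promiseStrategy]
    split_ifs
    exacts [hα _, hα' _]
  have hcase : ∀ h, ∃ (β : S → MixedAction B) (r : ℝ) (ξ : S → S → Y → ℝ) (k : ℝ),
      G.Feasible k β r ξ ∧ σ h = β (currentState s₀ h) ∧
      (fun t y => w (h ++ [(y, t)])) =
        fun t y => w h - c * (r - w h) + c * ξ (currentState s₀ h) t y := by
    intro h
    by_cases hz : z ≤ w h
    · refine ⟨α, v, x, l, hf, ?_, ?_⟩
      · simp only [σ, promiseStrategy]
        rw [if_pos hz, promise_snd]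
      · funext t y
        simp only [w, promise_append, promiseStep]
        rw [if_pos hz, promise_snd]
    · refine ⟨α', v', x', l', hf', ?_, ?_⟩
      · simp only [σ, promiseStrategy]
        rw [if_neg hz, promise_snd]
      · funext t y
        simp only [w, promise_append, promiseStep]
        rw [if_neg hz, promise_snd]
  have key := G.isPPE_of_oneShot h0 h1 s₀ (fun _ => σ) w hD (fun h i => ?_) (fun h i b => ?_)
  · exact ⟨fun _ => σ, ⟨key.1, fun _ _ _ => rfl⟩, fun _ h => hσA h, key.2⟩
  · obtain ⟨β, r, ξ, k, hβ, e₁, e₂⟩ := hcase h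
    rw [e₂, hc, G.mixExp_oneShot_transfer h0, e₁, ← hβ.value]
    ring
  · obtain ⟨β, r, ξ, k, hβ, e₁, e₂⟩ := hcase h
    rw [e₂, hc, G.mixExp_oneShot_transfer h0, e₁]
    have := mul_nonneg h1' (sub_nonneg.2 (hβ.incentive (currentState s₀ h) i b))
    linarith

theorem exists_bound_of_finite {κ : Type*} [Finite κ] (f : κ → ℝ) : ∃ M, 0 ≤ M ∧ ∀ k, |f k| ≤ M := by
  have := Fintype.ofFinite κ
  exact ⟨∑ k, |f k|, by positivity, fun k =>
    Finset.single_le_sum (f := fun k => |f k|) (fun _ _ => abs_nonneg _) (mem_univ k)⟩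

theorem exists_discount_Icc_subset [Nonempty B] [Nonempty S] (G : StochasticGame I S B Y)
    (A : Set (MixedAction B)) {zlo zhi : ℝ} (hz : zlo ≤ zhi)
    (hlo : -(G.scoreIn A (-1)) < (zlo : EReal)) (hhi : (zhi : EReal) < G.scoreIn A 1) :
    ∃ δ₀ : ℝ, 0 < δ₀ ∧ δ₀ < 1 ∧ ∀ δ : ℝ, δ₀ ≤ δ → δ < 1 →
      ∀ s, Set.Icc zlo zhi ⊆ G.sseSetIn A δ s := by
  -- Probabilities sum to one, so some signal exists; the potential lemma needs it to maximize over
  -- signals.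
  have hY : Nonempty Y := by
    by_contra hY
    rw [not_nonempty_iff] at hY
    have := G.p_sum (Classical.arbitrary S) (fun _ => Classical.arbitrary B)
    simp at this
  have hlo' : ((-zlo : ℝ) : EReal) < G.scoreIn A (-1) := by
    rw [EReal.coe_neg]
    exact EReal.neg_lt_comm.1 hlo
  obtain ⟨α, v, x, hα, hf, hv⟩ := G.exists_feasible_of_lt_scoreIn hhi
  obtain ⟨α', v', x', hα', hf', hv'⟩ := G.exists_feasible_of_lt_scoreIn hlo'
  obtain ⟨θ, hθ⟩ := exists_potential_of_transfers x fun T ξ ψ => by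
    simpa using hf.cycle T ξ ψ
  obtain ⟨θ', hθ'⟩ := exists_potential_of_transfers (fun s t y => -x' s t y) fun T ξ ψ => by
    simpa using hf'.cycle T ξ ψ
  obtain ⟨X₁, hX₁0, hX₁⟩ := exists_bound_of_finite fun k : S × S × Y => x k.1 k.2.1 k.2.2
  obtain ⟨X₂, hX₂0, hX₂⟩ := exists_bound_of_finite fun k : S × S × Y => x' k.1 k.2.1 k.2.2
  obtain ⟨Θ₁, hΘ₁0, hΘ₁⟩ := exists_bound_of_finite θ
  obtain ⟨Θ₂, hΘ₂0, hΘ₂⟩ := exists_bound_of_finite θ'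
  let Θ := Θ₁ + Θ₂
  let X := X₁ + X₂
  let K := X + (v - v') + Θ
  have hK : 0 < K + Θ := by simp only [K, X, Θ]; linarith
  obtain ⟨ε, hε, hε₁, hε₂⟩ : ∃ ε > 0, ε ≤ v - zhi ∧ ε ≤ zlo - v' :=
    ⟨min (v - zhi) (zlo - v'), lt_min (by linarith) (by linarith), min_le_left _ _,
      min_le_right _ _⟩
  have hc₀ : 0 < ε / (K + Θ) := div_pos hε hK
  -- This threshold is equivalent to `(1 - δ) / δ * (K + Θ) ≤ ε`: promises then stay between `v'`
  -- and `v`, uniformly over targets in the interval and initial states.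
  refine ⟨1 / (1 + ε / (K + Θ)), by positivity, ?_, fun δ hδ h1 s z hzz => ?_⟩
  · rw [div_lt_one (by positivity)]
    linarith
  have h0 : 0 < δ := lt_of_lt_of_le (by positivity) hδ
  have hc : 0 ≤ (1 - δ) / δ := div_nonneg (by linarith) h0.le
  have hcε : (1 - δ) / δ * (K + Θ) ≤ ε := by
    rw [← le_div_iff₀ hK, div_le_iff₀ h0]
    rw [div_le_iff₀ (by positivity)] at hδ
    linarith
  refine G.mem_sseSetIn_of_promise_bounded hα hα' hf hf' h0 h1 s (D := |z| + ε) fun h => ?_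
  have hb := promise_bounds (v := v) (v' := v') (x := x) (x' := x') (z := z) (θ := θ)
    (θ' := fun s => -θ' s) (X := X) (Θ := Θ) (K := K) hc hθ
    (fun s t y => by linarith [hθ' s t y])
    (fun s t y => (hX₁ (s, t, y)).trans (by simp only [X]; linarith))
    (fun s t y => (hX₂ (s, t, y)).trans (by simp only [X]; linarith))
    (fun s => (hΘ₁ s).trans (by simp only [Θ]; linarith))
    (fun s => by rw [abs_neg]; exact (hΘ₂ s).trans (by simp only [Θ]; linarith))
    (by positivity) (by linarith [hzz.1]) (by linarith [hzz.2]) le_rfl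
    (by linarith [hzz.2]) (by linarith [hzz.1]) s h
  have := abs_le.1 (le_refl |z|)
  rw [abs_le]
  constructor <;> linarith

/-! ### Both statements for a set of actions, then the mixed and pure cases. -/

theorem folk_theorem_in [Nonempty I] [Nonempty S] [Nonempty B] (G : StochasticGame I S B Y)
    (hG : G.IsSymmetric) (A : Set (MixedAction B)) :
    (∀ δ : ℝ, 0 < δ → δ < 1 → ∀ v ∈ ⋂ s, G.sseSetIn A δ s,
        (v : EReal) ∈ Set.Icc (-(G.scoreIn A (-1))) (G.scoreIn A 1)) ∧
      (∀ zlo zhi : ℝ, zlo ≤ zhi → -(G.scoreIn A (-1)) < (zlo : EReal) →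
        (zhi : EReal) < G.scoreIn A 1 →
        ∃ δ₀ : ℝ, 0 < δ₀ ∧ δ₀ < 1 ∧ ∀ δ : ℝ, δ₀ ≤ δ → δ < 1 →
          ∀ s, Set.Icc zlo zhi ⊆ G.sseSetIn A δ s) := by
  refine ⟨fun δ h0 h1 v hv => ?_, fun zlo zhi hz hlo hhi =>
    G.exists_discount_Icc_subset A hz hlo hhi⟩
  rw [Set.mem_iInter] at hv
  have h₁ := G.score_ge_of_mem hG A h0 h1 (l := 1) (by norm_num) hv
  have h₂ := G.score_ge_of_mem hG A h0 h1 (l := -1) (by norm_num) hv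
  rw [one_mul] at h₁
  rw [neg_one_mul, EReal.coe_neg] at h₂
  exact ⟨EReal.neg_le.1 h₂, h₁⟩

theorem sseSetIn_univ (G : StochasticGame I S B Y) (δ : ℝ) (s : S) :
    G.sseSetIn Set.univ δ s = G.sseSet δ s := by
  simp [sseSetIn, sseSet]

theorem scoreIn_univ (G : StochasticGame I S B Y) (l : ℝ) : G.scoreIn Set.univ l = G.kSS l := by
  simp [scoreIn, kSS]

theorem sseSetIn_pure (G : StochasticGame I S B Y) (δ : ℝ) (s : S) :
    G.sseSetIn {β | ∃ b, β = pureAction b} δ s = G.pureSseSet δ s := rfl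

theorem scoreIn_pure (G : StochasticGame I S B Y) (l : ℝ) :
    G.scoreIn {β | ∃ b, β = pureAction b} l = G.kSSPure l := by
  unfold scoreIn kSSPure
  congr 1
  ext r
  constructor
  · rintro ⟨α, v, x, hα, hf, rfl⟩
    choose a ha using hα
    obtain rfl : α = fun s => pureAction (a s) := funext ha
    exact ⟨a, v, x, hf, rfl⟩
  · rintro ⟨a, v, x, hf, rfl⟩
    exact ⟨_, v, x, fun s => ⟨a s, rfl⟩, hf, rfl⟩

end StochasticGame

end

theorem mainTheorem2 {I S B Y : Type*} [Fintype I] [DecidableEq I] [Nonempty I]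
    [Fintype S] [Nonempty S] [Fintype B] [DecidableEq B] [Nonempty B] [Fintype Y]
    (G : StochasticGame I S B Y) (hG : G.IsSymmetric) :
    ((∀ δ : ℝ, 0 < δ → δ < 1 → ∀ v ∈ ⋂ s, G.sseSet δ s,
        (v : EReal) ∈ Set.Icc (-(G.kSS (-1))) (G.kSS 1)) ∧
      (∀ zlo zhi : ℝ, zlo ≤ zhi → -(G.kSS (-1)) < (zlo : EReal) → (zhi : EReal) < G.kSS 1 →
        ∃ δ₀ : ℝ, 0 < δ₀ ∧ δ₀ < 1 ∧ ∀ δ : ℝ, δ₀ ≤ δ → δ < 1 →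
          ∀ s, Set.Icc zlo zhi ⊆ G.sseSet δ s)) ∧
    ((∀ δ : ℝ, 0 < δ → δ < 1 → ∀ v ∈ ⋂ s, G.pureSseSet δ s,
        (v : EReal) ∈ Set.Icc (-(G.kSSPure (-1))) (G.kSSPure 1)) ∧
      (∀ zlo zhi : ℝ, zlo ≤ zhi → -(G.kSSPure (-1)) < (zlo : EReal) →
        (zhi : EReal) < G.kSSPure 1 →
        ∃ δ₀ : ℝ, 0 < δ₀ ∧ δ₀ < 1 ∧ ∀ δ : ℝ, δ₀ ≤ δ → δ < 1 →
          ∀ s, Set.Icc zlo zhi ⊆ G.pureSseSet δ s)) := by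
  have h₁ := G.folk_theorem_in hG Set.univ
  have h₂ := G.folk_theorem_in hG {β | ∃ b, β = pureAction b}
  simp only [StochasticGame.sseSetIn_univ, StochasticGame.scoreIn_univ] at h₁
  simp only [StochasticGame.sseSetIn_pure, StochasticGame.scoreIn_pure] at h₂
  exact ⟨h₁, h₂⟩
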